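/- Let $d\ge 1$ and let $\Delta_d$ be the set of vectors $h=(h_1,\dots,h_d)$ with $0<h_1\le\dots\le h_d\le 1$. For $h\in\Delta_d$ let $\mathcal P_h$ be the real linear span of the functions $t\mapsto t^{m_i}e^{-h_it}$, $1\le i\le d$, where $m_i=\#\{j<i : h_j=h_i\}$. Write $\|f\|_{\mathbb R_+}=\sup_{t\ge 0}|f(t)|$, let $e=(1,\dots,1)\in\mathbb R^d$ (so that $\mathcal P_e$ consists of the functions $e^{-t}q(t)$ with $q$ a real algebraic polynomial of degree at most $d-1$), and put $$M_{k,d}=\sup\{\|p^{(k)}\|_{\mathbb R_+} : p\in\mathcal P_e,\ \|p\|_{\mathbb R_+}\le 1\}.$$ Then there is exactly one function $S_d\in\mathcal P_e$ with $\|S_d\|_{\mathbb R_+}=1$ for which there exist points $0=\nu_1<\nu_2<\dots<\nu_d$ with $S_d(\nu_i)=(-1)^i$ for $i=1,\dots,d$. Moreover, for every integer $k\ge 1$, every $h\in\Delta_d$ and every $p\in\mathcal P_h$, $$\|p^{(k)}\|_{\mathbb R_+}\le M_{k,d}\,\|p\|_{\mathbb R_+},$$ and equality holds if and only if $p=c\,S_d$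 for some $c\in\mathbb R$ (the value $c=0$ being the trivial case $p=0$). -/

import Mathlib

/-! Exponential polynomials on the half-line and their Chebyshev polynomials. -/

noncomputable section

/-- The uniform norm `‖f‖ = sup_{t ≥ 0} |f t|` on the half-line. Exponential polynomials with
positive exponents are bounded there, together with all their derivatives. -/
def halfLineNorm (f : ℝ → ℝ) : ℝ :=
  sSup ((fun t : ℝ => |f t|) '' Set.Ici 0)

/-- The set of ordered vectors `0 < h₁ ≤ … ≤ h_d ≤ 1`. -/
def orderedExponents (d : ℕ) : Set (Fin d → ℝ) :=
  {h | Monotone h ∧ ∀ i, 0 < h i ∧ h i ≤ 1}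

/-- The `i`-th function `t ^ m * exp (-h_i t)` of the system of exponents of `h`, where `m` is the
number of earlier indices carrying the same exponent. -/
def expSystem {d : ℕ} (h : Fin d → ℝ) (i : Fin d) : ℝ → ℝ :=
  fun t => t ^ (Nat.card {j : Fin d // j < i ∧ h j = h i}) * Real.exp (-(h i) * t)

/-- The space of exponential polynomials with exponents `h`. -/
def expPoly {d : ℕ} (h : Fin d → ℝ) : Submodule ℝ (ℝ → ℝ) :=
  Submodule.span ℝ (Set.range (expSystem h))

/-- The optimal value `M_k(h)` of the problem of maximizing `‖p^{(k)}‖` over the exponential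
polynomials `p` with exponents `h` and `‖p‖ ≤ 1`. -/
def markovConst (k : ℕ) {d : ℕ} (h : Fin d → ℝ) : ℝ :=
  sSup {x | ∃ p ∈ expPoly h, halfLineNorm p ≤ 1 ∧ x = halfLineNorm (iteratedDeriv k p)}

/-- `T` is the Chebyshev polynomial of the exponents `h`: it lies in the space, has norm one, and
takes the values `-1, 1, -1, …` at `d` points `0 = ν₁ < ν₂ < … < ν_d`
(the index `i : Fin d` starts at `0`). -/
def IsChebyshevExpPoly {d : ℕ} (h : Fin d → ℝ) (T : ℝ → ℝ) : Prop :=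
  T ∈ expPoly h ∧ halfLineNorm T = 1 ∧
    ∃ ν : Fin d → ℝ, StrictMono ν ∧ (∀ i : Fin d, (i : ℕ) = 0 → ν i = 0) ∧
      ∀ i : Fin d, T (ν i) = (-1) ^ ((i : ℕ) + 1)

/-- The vector of ones. -/
def onesVec (d : ℕ) : Fin d → ℝ := fun _ => 1

end

open Polynomial Filter Topology
open scoped ContDiff

/-! Every element of the space with exponents `h` is annihilated by `∏ (D + h_i)`. Since `(D + a) f
= e^{-at} (e^{at} f)'`, Rolle's theorem applies factor by factor: a nonzero element has at most `d -
1` real zeros (`eq_zero_of_zeros`), so interpolation at `d` nodes is uniquely solvable, and `d + 1`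
weak alternations of `f` force a sign of `∏ (D + h_i) f` (`op_sign_of_weakAlt`). As all exponents
are positive, solutions decay, infinity acts as one more zero, and differentiation loses no
alternations (`weakAlt_D`).

Let `S` alternate at `d` nodes starting from `0`, and let `q` be the function with exponents `h`
taking the same values there. If `P` is bounded by `N`, then `N q - P` alternates weakly at the
nodes; its `k`-th derivative alternates at `d` positive points, and the wrong sign at `0` would give
one alternation too many. Hence `|P^{(k)}(0)|` is at most `N |q^{(k)}(0)|`
(`eq_or_abs_D_pow_zero_lt`). Raising one exponent strictly increases `|q^{(k)}(0)|`
(`D_pow_zero_lt_of_exponent_lt`), so moving the exponents to `1` one at a time replaces `q` by `S`.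
Translation carries the bound from `0` to every `t ≥ 0`.

Equality makes some translate of `P` a multiple of `S`. A nontrivial translate would keep `|S| ≤ 1`
slightly to the left of `0`, contradicting `S(0) = -1` and `S'(0) > 0`. Existence of `S` comes from
maximizing a signed leading coefficient; uniqueness, from comparing `S'(0)` for two candidates. -/

/-- The space of smooth real functions. -/
def smoothSpace : Submodule ℝ (ℝ → ℝ) where
  carrier := {f | ContDiff ℝ ∞ f}
  add_mem' {f g} hf hg := by
    have hf' : ContDiff ℝ ∞ f := hf
    have hg' : ContDiff ℝ ∞ g := hg
    exact hf'.add hg'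
  zero_mem' := (contDiff_const : ContDiff ℝ ∞ fun _ : ℝ => (0 : ℝ))
  smul_mem' c f hf := by
    have hf' : ContDiff ℝ ∞ f := hf
    exact hf'.const_smul c

/-! ### Constant-coefficient differential operators on smooth functions. -/

namespace smoothSpace

theorem contDiff_coe (f : smoothSpace) : ContDiff ℝ ∞ f.1 := f.2

theorem differentiable_coe (f : smoothSpace) : Differentiable ℝ f.1 :=
  (contDiff_coe f).differentiable (by simp)

theorem continuous_coe (f : smoothSpace) : Continuous f.1 := (contDiff_coe f).continuous

/-- Differentiation of smooth functions. -/
noncomputable def D : Module.End ℝ smoothSpace where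
  toFun f := ⟨deriv f.1, (contDiff_infty_iff_deriv.1 f.2).2⟩
  map_add' f g := by
    ext t
    exact deriv_add (differentiable_coe f t) (differentiable_coe g t)
  map_smul' c f := by
    ext t
    exact deriv_const_smul c (differentiable_coe f t)

theorem coe_D_pow (k : ℕ) (f : smoothSpace) : ((D ^ k) f).1 = iteratedDeriv k f.1 := by
  induction k generalizing f with
  | zero => simp
  | succ k ih => rw [pow_succ, iteratedDeriv_succ']; exact ih (D f)

theorem hasDerivAt_coe (f : smoothSpace) (t : ℝ) : HasDerivAt f.1 ((D f).1 t) t :=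
  (differentiable_coe f t).hasDerivAt

/-- The translate `s ↦ f (s + t)`. -/
def shift (t : ℝ) : Module.End ℝ smoothSpace where
  toFun f := ⟨fun s => f.1 (s + t), (contDiff_coe f).comp (contDiff_id.add contDiff_const)⟩
  map_add' _ _ := rfl
  map_smul' _ _ := rfl

theorem shift_apply (t : ℝ) (f : smoothSpace) (s : ℝ) : (shift t f).1 s = f.1 (s + t) := rfl

theorem D_shift (t : ℝ) (f : smoothSpace) : D (shift t f) = shift t (D f) := by
  ext s
  exact deriv_comp_add_const f.1 t s

theorem D_pow_shift (k : ℕ) (t : ℝ) (f : smoothSpace) :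
    (D ^ k) (shift t f) = shift t ((D ^ k) f) := by
  induction k generalizing f with
  | zero => simp
  | succ k ih => simp [pow_succ, D_shift, ih]

/-- The differential operator `∏ (D + a)`, the product being over the list `l`. -/
noncomputable def op (l : List ℝ) : Module.End ℝ smoothSpace :=
  aeval D ((l.map fun a => X + C a).prod)

theorem op_nil (f : smoothSpace) : op [] f = f := by simp [op]

theorem op_cons (a : ℝ) (l : List ℝ) (f : smoothSpace) : op (a :: l) f = op l (D f + a • f) := by
  simp only [op, List.map_cons, List.prod_cons]
  rw [mul_comm, map_mul, Module.End.mul_apply]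
  simp [Algebra.algebraMap_eq_smul_one]

theorem op_cons' (a : ℝ) (l : List ℝ) (f : smoothSpace) :
    op (a :: l) f = D (op l f) + a • op l f := by
  simp only [op, List.map_cons, List.prod_cons]
  rw [map_mul, Module.End.mul_apply]
  simp [Algebra.algebraMap_eq_smul_one]

theorem op_perm {l l' : List ℝ} (h : l.Perm l') : op l = op l' := by
  simp only [op, (h.map fun a => X + C a).prod_eq]

theorem op_D_pow (l : List ℝ) (k : ℕ) (f : smoothSpace) :
    op l ((D ^ k) f) = (D ^ k) (op l f) := by
  have : (D ^ k : Module.End ℝ smoothSpace) = aeval D (X ^ k : ℝ[X]) := by simp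
  rw [this, op, ← Module.End.mul_apply, ← map_mul, mul_comm, map_mul, Module.End.mul_apply]

theorem op_shift (l : List ℝ) (t : ℝ) (f : smoothSpace) :
    op l (shift t f) = shift t (op l f) := by
  induction l generalizing f with
  | nil => simp [op_nil]
  | cons a l ih => rw [op_cons, op_cons, ← ih, D_shift]; simp

theorem hasDerivAt_exp_mul (f : smoothSpace) (a t : ℝ) :
    HasDerivAt (fun s => Real.exp (a * s) * f.1 s)
      (Real.exp (a * t) * (D f + a • f).1 t) t := by
  have h1 : HasDerivAt (fun s => Real.exp (a * s)) (Real.exp (a * t) * a) t := by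
    simpa using ((hasDerivAt_id t).const_mul a).exp
  have h2 : (D f + a • f).1 t = (D f).1 t + a * f.1 t := rfl
  refine (h1.mul (hasDerivAt_coe f t)).congr_deriv ?_
  rw [h2]; ring

/-! ### Alternation of signs under `D + a`. -/

/-- Weak alternation of the signs of `f` at the first `n` points of the sequence `x`, which
increase; `σ` is the sign at the first point. -/
def WeakAlt (f : ℝ → ℝ) (n : ℕ) (x : ℕ → ℝ) (σ : ℝ) : Prop :=
  (∀ i, i + 1 < n → x i < x (i + 1)) ∧ ∀ i < n, 0 ≤ σ * (-1) ^ i * f (x i)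

/-- This is the mean value theorem for `e^{at} f`, whose derivative is `e^{at} (D f + a f)`. The
nonvanishing clause lets strictness survive repeated application. -/
theorem exists_sign_between (f : smoothSpace) (a : ℝ) {x y τ : ℝ} (hxy : x < y)
    (hx : τ * f.1 x ≤ 0) (hy : 0 ≤ τ * f.1 y) :
    ∃ ξ, x < ξ ∧ ξ < y ∧ 0 ≤ τ * (D f + a • f).1 ξ ∧
      (τ ≠ 0 → (f.1 x ≠ 0 ∨ f.1 y ≠ 0) → (D f + a • f).1 ξ ≠ 0) := by
  have hd := hasDerivAt_exp_mul f a
  obtain ⟨ξ, ⟨h1, h2⟩, h3⟩ := exists_hasDerivAt_eq_slope _ _ hxy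
    (fun t _ => (hd t).continuousAt.continuousWithinAt) (fun t _ => hd t)
  rw [eq_div_iff (sub_pos.2 hxy).ne'] at h3
  set g := (D f + a • f).1 ξ
  have e1 := Real.exp_pos (a * ξ)
  have e2 := Real.exp_pos (a * x)
  have e3 := Real.exp_pos (a * y)
  have hyx := sub_pos.2 hxy
  have key : Real.exp (a * ξ) * (y - x) * (τ * g) =
      Real.exp (a * y) * (τ * f.1 y) + Real.exp (a * x) * (-(τ * f.1 x)) := by
    linear_combination τ * h3
  have h4 : 0 ≤ Real.exp (a * y) * (τ * f.1 y) := mul_nonneg e3.le hy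
  have h5 : 0 ≤ Real.exp (a * x) * (-(τ * f.1 x)) := mul_nonneg e2.le (by linarith)
  refine ⟨ξ, h1, h2, ?_, ?_⟩
  · have : 0 ≤ Real.exp (a * ξ) * (y - x) * (τ * g) := by rw [key]; exact add_nonneg h4 h5
    exact nonneg_of_mul_nonneg_right this (mul_pos e1 hyx)
  · intro hτ hne hg
    rw [show g = 0 from hg, mul_zero, mul_zero] at key
    have h6 : Real.exp (a * y) * (τ * f.1 y) = 0 := by linarith
    have h7 : Real.exp (a * x) * (-(τ * f.1 x)) = 0 := by linarith
    simp only [mul_eq_zero, e2.ne', e3.ne', hτ, neg_eq_zero, false_or] at h6 h7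
    tauto

/-- Each factor `D + a` trades one alternation point for a flip of the initial sign, until one point
remains. A single nonzero value among the data propagates to a strict sign. -/
theorem op_sign_of_weakAlt (l : List ℝ) (f : smoothSpace) (x : ℕ → ℝ) {σ : ℝ} (hσ : σ ≠ 0)
    (h : WeakAlt f.1 (l.length + 1) x σ) :
    (∃ ξ, 0 ≤ σ * (-1) ^ l.length * (op l f).1 ξ) ∧
      ((∃ j ≤ l.length, f.1 (x j) ≠ 0) → ∃ ξ, 0 < σ * (-1) ^ l.length * (op l f).1 ξ) := by
  induction l generalizing f x σ with
  | nil =>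
    have h0 := h.2 0 (by simp)
    refine ⟨⟨x 0, by simpa [op_nil] using h0⟩, ?_⟩
    rintro ⟨j, hj, hne⟩
    obtain rfl : j = 0 := by simpa using hj
    refine ⟨x 0, ?_⟩
    rw [op_nil]
    exact lt_of_le_of_ne (by simpa using h0) (by simp [hσ, hne])
  | cons a l ih =>
    have H : ∀ i, i < l.length + 1 → ∃ ξ, x i < ξ ∧ ξ < x (i + 1) ∧
        0 ≤ -σ * (-1) ^ i * (D f + a • f).1 ξ ∧
        ((f.1 (x i) ≠ 0 ∨ f.1 (x (i + 1)) ≠ 0) → (D f + a • f).1 ξ ≠ 0) := by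
      intro i hi
      have hτ : -σ * (-1) ^ i ≠ 0 := by simp [hσ]
      obtain ⟨ξ, h1, h2, h3, h4⟩ := exists_sign_between f a (τ := -σ * (-1) ^ i)
        (h.1 i (by simpa using hi)) (by have := h.2 i (by simp; omega); linarith)
        (by have := h.2 (i + 1) (by simp; omega); rw [pow_succ] at this; linarith)
      exact ⟨ξ, h1, h2, h3, h4 hτ⟩
    choose! ξ h1 h2 h3 h4 using H
    have hw : WeakAlt (D f + a • f).1 (l.length + 1) ξ (-σ) :=
      ⟨fun i hi => (h2 i (by omega)).trans (h1 (i + 1) hi), h3⟩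
    have key := ih (D f + a • f) ξ (neg_ne_zero.2 hσ) hw
    have e : ∀ t, -σ * (-1) ^ l.length * (op l (D f + a • f)).1 t =
        σ * (-1) ^ (a :: l).length * (op (a :: l) f).1 t := by
      intro t; rw [op_cons, List.length_cons, pow_succ]; ring
    simp only [e] at key
    refine ⟨key.1, ?_⟩
    rintro ⟨j, hj, hne⟩
    apply key.2
    rw [List.length_cons] at hj
    rcases Nat.eq_zero_or_pos j with rfl | hj0
    · exact ⟨0, by omega, h4 0 (by omega) (Or.inl hne)⟩
    · obtain ⟨i, rfl⟩ : ∃ i, j = i + 1 := ⟨j - 1, by omega⟩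
      exact ⟨i, by omega, h4 i (by omega) (Or.inr hne)⟩

/-! ### Zeros and interpolation in the kernel of `op l`. -/

theorem exp_mul_eq_of_D_add_smul_eq_zero {f : smoothSpace} {a : ℝ} (h : D f + a • f = 0)
    (s t : ℝ) : Real.exp (a * s) * f.1 s = Real.exp (a * t) * f.1 t := by
  have hd : ∀ t, HasDerivAt (fun s => Real.exp (a * s) * f.1 s) 0 t := by
    intro t
    simpa only [h, Submodule.coe_zero, Pi.zero_apply, mul_zero] using hasDerivAt_exp_mul f a t
  exact is_const_of_deriv_eq_zero (fun t => (hd t).differentiableAt) (fun t => (hd t).deriv) s t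

/-- By Rolle for `e^{at} f`, the function `D f + a f` has one zero fewer and lies in the kernel of
the shorter operator, so it vanishes by induction; then `e^{at} f` is constant and has a zero. -/
theorem eq_zero_of_zeros (l : List ℝ) {f : smoothSpace} (hf : op l f = 0) (x : ℕ → ℝ)
    (hx : ∀ i, i + 1 < l.length → x i < x (i + 1)) (h0 : ∀ i < l.length, f.1 (x i) = 0) :
    f = 0 := by
  induction l generalizing f x with
  | nil => simpa [op_nil] using hf
  | cons a l ih =>
    rw [op_cons] at hf
    have H : ∀ i, i < l.length → ∃ ξ, x i < ξ ∧ ξ < x (i + 1) ∧ (D f + a • f).1 ξ = 0 := by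
      intro i hi
      have z1 := h0 i (by simp; omega)
      have z2 := h0 (i + 1) (by simp; omega)
      have hd := hasDerivAt_exp_mul f a
      obtain ⟨ξ, h1, h2⟩ := exists_hasDerivAt_eq_zero (hx i (by simpa using hi))
        (fun t _ => (hd t).continuousAt.continuousWithinAt) (by simp [z1, z2]) (fun t _ => hd t)
      exact ⟨ξ, h1.1, h1.2, by simpa [(Real.exp_pos _).ne'] using h2⟩
    choose! ξ h1 h2 h3 using H
    have hg := ih hf ξ (fun i hi => (h2 i (by omega)).trans (h1 (i + 1) hi)) h3
    ext t
    have := exp_mul_eq_of_D_add_smul_eq_zero hg t (x 0)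
    rw [h0 0 (by simp), mul_zero] at this
    simpa [(Real.exp_pos _).ne'] using this

theorem exists_D_add_smul_eq (a : ℝ) (g : smoothSpace) : ∃ f : smoothSpace, D f + a • f = g := by
  have hc : Continuous fun s => Real.exp (a * s) * g.1 s := by
    have := (continuous_coe g); fun_prop
  set G : ℝ → ℝ := fun t => ∫ s in (0:ℝ)..t, Real.exp (a * s) * g.1 s
  have hG : ∀ t, HasDerivAt G (Real.exp (a * t) * g.1 t) t := fun t =>
    intervalIntegral.integral_hasDerivAt_right (hc.intervalIntegrable _ _)
      (hc.stronglyMeasurableAtFilter _ _) hc.continuousAt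
  have hGs : ContDiff ℝ ∞ G := by
    refine contDiff_infty_iff_deriv.2 ⟨fun t => (hG t).differentiableAt, ?_⟩
    rw [show deriv G = fun t => Real.exp (a * t) * g.1 t from funext fun t => (hG t).deriv]
    have := (contDiff_coe g); fun_prop
  refine ⟨⟨fun t => Real.exp (-(a * t)) * G t, ?_⟩, ?_⟩
  · change ContDiff ℝ ∞ _
    fun_prop
  · ext t
    have h1 : HasDerivAt (fun s => Real.exp (-(a * s))) (Real.exp (-(a * t)) * -a) t := by
      simpa using ((hasDerivAt_id t).const_mul a).neg.exp
    have h2 := (h1.mul (hG t)).deriv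
    change deriv (fun t => Real.exp (-(a * t)) * G t) t + a * (Real.exp (-(a * t)) * G t) = g.1 t
    rw [show (fun t => Real.exp (-(a * t)) * G t) = (fun s => Real.exp (-(a * s))) * G from rfl,
      h2]
    have h3 : Real.exp (-(a * t)) * Real.exp (a * t) = 1 := by rw [← Real.exp_add]; simp
    linear_combination g.1 t * h3

/-- The exponential `t ↦ exp (-a t)` as a smooth function. -/
noncomputable def expNeg (a : ℝ) : smoothSpace :=
  ⟨fun t => Real.exp (-a * t), by change ContDiff ℝ ∞ _; fun_prop⟩

theorem D_expNeg (a : ℝ) : D (expNeg a) + a • expNeg a = 0 := by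
  ext t
  have h1 : HasDerivAt (fun s => Real.exp (-a * s)) (Real.exp (-a * t) * -a) t := by
    simpa using ((hasDerivAt_id t).const_mul (-a)).exp
  change deriv (fun s => Real.exp (-a * s)) t + a * Real.exp (-a * t) = 0
  rw [h1.deriv]; ring

/-- Preimages under `D + a` of an independent family for the tail stay independent, and `e^{-at}`,
which `D + a` kills, can be adjoined. -/
theorem exists_linearIndependent_ker_op (l : List ℝ) :
    ∃ b : Fin l.length → smoothSpace, LinearIndependent ℝ b ∧ ∀ i, op l (b i) = 0 := by
  induction l with
  | nil => exact ⟨fun i => Fin.elim0 i, Fintype.linearIndependent_iff.2 fun _ _ i => Fin.elim0 i,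
    fun i => Fin.elim0 i⟩
  | cons a l ih =>
    obtain ⟨b, hb, hb0⟩ := ih
    choose c hc using fun i => exists_D_add_smul_eq a (b i)
    let T : Module.End ℝ smoothSpace := D + a • 1
    have hT : ∀ f, T f = D f + a • f := fun f => rfl
    have hTc : T ∘ c = b := funext hc
    have hcl : LinearIndependent ℝ c := LinearIndependent.of_comp T (by rw [hTc]; exact hb)
    refine ⟨Fin.cons (expNeg a) c, ?_, ?_⟩
    · refine linearIndependent_finCons.2 ⟨hcl, fun hmem => ?_⟩
      obtain ⟨w, hw⟩ := (Submodule.mem_span_range_iff_exists_fun ℝ).1 hmem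
      have h1 : ∑ i, w i • b i = 0 := by
        have := congrArg T hw
        rw [map_sum, hT (expNeg a), D_expNeg] at this
        rw [← this]
        exact Finset.sum_congr rfl fun i _ => by rw [map_smul, hT, hc]
      have h2 := Fintype.linearIndependent_iff.1 hb w h1
      have h3 : expNeg a = 0 := by rw [← hw]; simp [h2]
      have h4 : (expNeg a).1 0 = 0 := by rw [h3]; rfl
      simp [expNeg] at h4
    · intro i
      refine Fin.cases ?_ (fun i => ?_) i
      · rw [Fin.cons_zero, op_cons, D_expNeg, map_zero]
      · rw [Fin.cons_succ, op_cons, hc, hb0]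

/-- Evaluation at the nodes is injective on the span of `l.length` independent solutions by the zero
count, hence surjective by dimension. -/
theorem exists_interpolant (l : List ℝ) (x : ℕ → ℝ)
    (hx : ∀ i, i + 1 < l.length → x i < x (i + 1)) (y : ℕ → ℝ) :
    ∃ f : smoothSpace, op l f = 0 ∧ ∀ i < l.length, f.1 (x i) = y i := by
  obtain ⟨b, hb, hb0⟩ := exists_linearIndependent_ker_op l
  let E : smoothSpace →ₗ[ℝ] (Fin l.length → ℝ) :=
    { toFun := fun f i => f.1 (x i), map_add' := fun _ _ => rfl, map_smul' := fun _ _ => rfl }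
  have hli : LinearIndependent ℝ (E ∘ b) := by
    rw [Fintype.linearIndependent_iff]
    intro w hw
    refine Fintype.linearIndependent_iff.1 hb w (eq_zero_of_zeros l ?_ x hx ?_)
    · simp [map_sum, hb0]
    · intro i hi
      have : E (∑ i, w i • b i) = 0 := by simpa [map_sum] using hw
      exact congrFun this ⟨i, hi⟩
  have htop := hli.span_eq_top_of_card_eq_finrank' (by simp)
  have hmem : (fun i : Fin l.length => y i) ∈ Submodule.span ℝ (Set.range (E ∘ b)) := by
    rw [htop]; trivial
  obtain ⟨w, hw⟩ := (Submodule.mem_span_range_iff_exists_fun ℝ).1 hmem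
  refine ⟨∑ i, w i • b i, by simp [map_sum, hb0], fun i hi => ?_⟩
  have : E (∑ i, w i • b i) = fun i : Fin l.length => y i := by
    rw [← hw]; simp [map_sum]
  exact congrFun this ⟨i, hi⟩

/-! ### Decay at infinity and alternation of derivatives. -/

theorem tendsto_zero_of_D_add_smul {f : smoothSpace} {a : ℝ} (ha : 0 < a)
    (h : Tendsto (D f + a • f).1 atTop (𝓝 0)) : Tendsto f.1 atTop (𝓝 0) := by
  have upper : ∀ f : smoothSpace, Tendsto (D f + a • f).1 atTop (𝓝 0) →
      ∀ ε > 0, ∀ᶠ t in atTop, f.1 t < ε := by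
    intro f h ε hε
    obtain ⟨T, hT⟩ := eventually_atTop.1 (h.eventually (gt_mem_nhds (show 0 < a * (ε / 2) by positivity)))
    -- The constant `ε / 2` solves `(D + a) y = a ε / 2`, which dominates the right-hand side beyond
    -- `T`; so `e^{as} (f - ε / 2)` is nonincreasing there.
    have hd : ∀ t, HasDerivAt (fun s => Real.exp (a * s) * (f.1 s - ε / 2))
        (Real.exp (a * t) * ((D f + a • f).1 t - a * (ε / 2))) t := by
      intro t
      have h1 : HasDerivAt (fun s => Real.exp (a * s)) (Real.exp (a * t) * a) t := by
        simpa using ((hasDerivAt_id t).const_mul a).exp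
      have h2 : (D f + a • f).1 t = (D f).1 t + a * f.1 t := rfl
      refine (h1.mul ((hasDerivAt_coe f t).sub_const (ε / 2))).congr_deriv ?_
      rw [h2]; ring
    have hanti : AntitoneOn (fun s => Real.exp (a * s) * (f.1 s - ε / 2)) (Set.Ici T) := by
      refine antitoneOn_of_deriv_nonpos (convex_Ici T)
        (fun t _ => (hd t).continuousAt.continuousWithinAt)
        (fun t _ => (hd t).differentiableAt.differentiableWithinAt) (fun t ht => ?_)
      rw [(hd t).deriv]
      rw [interior_Ici] at ht
      exact mul_nonpos_of_nonneg_of_nonpos (Real.exp_pos _).le (by linarith [hT t (le_of_lt ht)])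
    set K := Real.exp (a * T) * (f.1 T - ε / 2)
    have hlim : Tendsto (fun t => K * Real.exp (-(a * t))) atTop (𝓝 0) := by
      have : Tendsto (fun t : ℝ => a * t) atTop atTop := tendsto_id.const_mul_atTop ha
      simpa using (Real.tendsto_exp_neg_atTop_nhds_zero.comp this).const_mul K
    filter_upwards [eventually_ge_atTop T, hlim.eventually (gt_mem_nhds (half_pos hε))] with t h1 h2
    have h3 : Real.exp (a * t) * (f.1 t - ε / 2) ≤ K := hanti (Set.mem_Ici.2 le_rfl) h1 h1
    have h4 : Real.exp (-(a * t)) * Real.exp (a * t) = 1 := by rw [← Real.exp_add]; simp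
    have h5 := mul_le_mul_of_nonneg_left h3 (Real.exp_pos (-(a * t))).le
    rw [← mul_assoc, h4] at h5
    linarith
  rw [Metric.tendsto_nhds]
  intro ε hε
  have h' : Tendsto (D (-f) + a • (-f)).1 atTop (𝓝 0) := by
    have e : (D (-f) + a • (-f)) = -(D f + a • f) := by simp [map_neg]; abel
    rw [e]
    have := h.neg
    rw [neg_zero] at this
    exact this
  filter_upwards [upper f h ε hε, upper (-f) h' ε hε] with t h1 h2
  rw [Real.dist_eq, sub_zero, abs_lt]
  have : (-f).1 t = -f.1 t := rfl
  constructor <;> linarith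

theorem tendsto_zero {l : List ℝ} (hl : ∀ a ∈ l, 0 < a) {f : smoothSpace} (hf : op l f = 0) :
    Tendsto f.1 atTop (𝓝 0) := by
  induction l generalizing f with
  | nil =>
    rw [op_nil] at hf; subst hf; exact tendsto_const_nhds
  | cons a l ih =>
    rw [op_cons] at hf
    exact tendsto_zero_of_D_add_smul (hl a (by simp)) (ih (fun b hb => hl b (by simp [hb])) hf)

theorem op_D_pow_eq_zero {l : List ℝ} {f : smoothSpace} (hf : op l f = 0) (k : ℕ) :
    op l ((D ^ k) f) = 0 := by rw [op_D_pow, hf, map_zero]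

/-- Otherwise `τ f` would increase strictly from a nonnegative value and could not tend to `0`. -/
theorem exists_D_sign_after {f : smoothSpace} (hf : Tendsto f.1 atTop (𝓝 0)) {x τ : ℝ}
    (hx : 0 ≤ τ * f.1 x) : ∃ y, x < y ∧ 0 ≤ -τ * (D f).1 y := by
  by_contra! hcon
  have hmono : StrictMonoOn (fun t => τ * f.1 t) (Set.Ici x) := by
    refine strictMonoOn_of_deriv_pos (convex_Ici x)
      (((continuous_coe f).const_mul τ).continuousOn) fun t ht => ?_
    rw [interior_Ici] at ht
    rw [((hasDerivAt_coe f t).const_mul τ).deriv]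
    linarith [hcon t ht]
  have h1 : τ * f.1 x < τ * f.1 (x + 1) := hmono (by simp) (by simp) (by linarith)
  have h2 : Tendsto (fun t => τ * f.1 t) atTop (𝓝 0) := by simpa using hf.const_mul τ
  have h3 : τ * f.1 (x + 1) ≤ 0 := by
    refine ge_of_tendsto h2 ?_
    filter_upwards [eventually_ge_atTop (x + 1)] with t ht
    exact hmono.monotoneOn (by simp) (by simp; linarith) ht
  linarith

/-- Consecutive points give `n - 1` points for the derivative, and the decay after the last point
supplies the missing one. All new points lie to the right of `x 0`, which leaves room to add `0`
later. -/
theorem weakAlt_D {f : smoothSpace} (hf : Tendsto f.1 atTop (𝓝 0)) {n : ℕ} {x : ℕ → ℝ} {σ : ℝ}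
    (hn : 1 ≤ n) (h : WeakAlt f.1 n x σ) : ∃ y, x 0 < y 0 ∧ WeakAlt (D f).1 n y (-σ) := by
  have H : ∀ i, i < n → ∃ ξ, x i < ξ ∧ (i + 1 < n → ξ < x (i + 1)) ∧
      0 ≤ -σ * (-1) ^ i * (D f).1 ξ := by
    intro i hi
    by_cases hi' : i + 1 < n
    · obtain ⟨ξ, h1, h2, h3, -⟩ := exists_sign_between f 0 (τ := -σ * (-1) ^ i) (h.1 i hi')
        (by have := h.2 i hi; linarith)
        (by have := h.2 (i + 1) hi'; rw [pow_succ] at this; linarith)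
      exact ⟨ξ, h1, fun _ => h2, by simpa using h3⟩
    · obtain ⟨ξ, h1, h2⟩ := exists_D_sign_after hf (h.2 i hi)
      exact ⟨ξ, h1, fun h => absurd h hi', by linarith⟩
  choose! ξ h1 h2 h3 using H
  exact ⟨ξ, h1 0 hn, fun i hi => (h2 i (by omega) hi).trans (h1 (i + 1) hi), h3⟩

theorem weakAlt_D_pow {l : List ℝ} (hl : ∀ a ∈ l, 0 < a) {f : smoothSpace} (hf : op l f = 0)
    {n : ℕ} {x : ℕ → ℝ} {σ : ℝ} (hn : 1 ≤ n) (h : WeakAlt f.1 n x σ) {k : ℕ} (hk : 1 ≤ k) :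
    ∃ y, x 0 < y 0 ∧ WeakAlt ((D ^ k) f).1 n y (σ * (-1) ^ k) := by
  induction k, hk using Nat.le_induction with
  | base => simpa using weakAlt_D (tendsto_zero hl hf) hn h
  | succ k hk ih =>
    obtain ⟨y, hy, hw⟩ := ih
    obtain ⟨z, hz, hw'⟩ := weakAlt_D (tendsto_zero hl (op_D_pow_eq_zero hf k)) hn hw
    refine ⟨z, hy.trans hz, ?_⟩
    rw [pow_succ', Module.End.mul_apply, pow_succ]
    convert hw' using 1
    ring

/-- Prepending the point `0` to a weak alternation on the positive half-line. -/
theorem WeakAlt.cons_zero {f : ℝ → ℝ} {n : ℕ} {y : ℕ → ℝ} {σ : ℝ} (h : WeakAlt f n y σ)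
    (hy : 0 < y 0) (h0 : 0 ≤ -σ * f 0) :
    WeakAlt f (n + 1) (fun i => Nat.casesOn i 0 y) (-σ) := by
  refine ⟨fun i hi => ?_, fun i hi => ?_⟩
  · cases i with
    | zero => exact hy
    | succ i => exact h.1 i (by omega)
  · cases i with
    | zero => simpa using h0
    | succ i =>
      have := h.2 i (by omega)
      rw [pow_succ]
      simpa using this

theorem D_ne_zero {l : List ℝ} (hl : ∀ a ∈ l, 0 < a) {f : smoothSpace} (hf : op l f = 0)
    (hne : f ≠ 0) : D f ≠ 0 := by
  intro h0
  apply hne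
  have hc : ∀ s t, f.1 s = f.1 t := is_const_of_deriv_eq_zero (differentiable_coe f)
    (fun t => congrFun (congrArg Subtype.val h0) t)
  ext t
  have h1 : Tendsto f.1 atTop (𝓝 (f.1 t)) := by
    rw [show f.1 = fun _ => f.1 t from funext fun s => hc s t]; exact tendsto_const_nhds
  exact tendsto_nhds_unique h1 (tendsto_zero hl hf)

theorem D_pow_ne_zero {l : List ℝ} (hl : ∀ a ∈ l, 0 < a) {f : smoothSpace} (hf : op l f = 0)
    (hne : f ≠ 0) (k : ℕ) : (D ^ k) f ≠ 0 := by
  induction k with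
  | zero => simpa
  | succ k ih =>
    rw [pow_succ', Module.End.mul_apply]
    exact D_ne_zero hl (op_D_pow_eq_zero hf k) ih

/-- With the wrong sign at `0`, the `k`-th derivative would have `l.length + 1` weak alternations,
although `op l` annihilates it. If all those values vanished, the zero count would make the
derivative zero. -/
theorem D_pow_zero_sign {l : List ℝ} (hl : ∀ a ∈ l, 0 < a) (hn : 1 ≤ l.length) {f : smoothSpace}
    (hf : op l f = 0) (hne : f ≠ 0) {x : ℕ → ℝ} (hx : 0 ≤ x 0) {σ : ℝ} (hσ : σ ≠ 0)
    (h : WeakAlt f.1 l.length x σ) {k : ℕ} (hk : 1 ≤ k) :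
    0 < σ * (-1) ^ k * ((D ^ k) f).1 0 := by
  obtain ⟨y, hy, hw⟩ := weakAlt_D_pow hl hf hn h hk
  by_contra hcon
  have hc := hw.cons_zero (hx.trans_lt hy) (by linarith)
  have hσ' : -(σ * (-1) ^ k) ≠ 0 := by simp [hσ]
  have hop := op_D_pow_eq_zero hf k
  obtain ⟨ξ, hξ⟩ := (op_sign_of_weakAlt l _ _ hσ' hc).2 (by
    by_contra! hz
    exact D_pow_ne_zero hl hf hne k
      (eq_zero_of_zeros l hop _ (fun i hi => hc.1 i (by omega)) fun i hi => hz i hi.le))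
  rw [hop] at hξ
  simp at hξ

/-! ### Comparison of interpolants as the exponents vary. -/

theorem eq_of_eq_on_nodes {l : List ℝ} {p q : smoothSpace} (hp : op l p = 0) (hq : op l q = 0)
    (x : ℕ → ℝ) (hx : ∀ i, i + 1 < l.length → x i < x (i + 1))
    (h : ∀ i < l.length, p.1 (x i) = q.1 (x i)) : p = q :=
  sub_eq_zero.1 <| eq_zero_of_zeros l (by rw [map_sub, hp, hq, sub_zero]) x hx fun i hi =>
    sub_eq_zero.2 (h i hi)

/-- The difference `r = p - q` has only `w.length + 1` known zeros in a kernel of order `w.length +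
2`, so the zero count alone does not decide. But `op (b :: w) r` is `(b - a)` times `u = op w p`, a
multiple of `e^{-at}` whose sign is fixed by the alternation of `p`. -/
theorem D_pow_zero_lt_of_exponent_lt {a b : ℝ} {w : List ℝ} (ha : 0 < a) (hab : a < b)
    (hw : ∀ c ∈ w, 0 < c) {p q : smoothSpace} (hp : op (a :: w) p = 0) (hq : op (b :: w) q = 0)
    {x : ℕ → ℝ} (hx0 : 0 ≤ x 0) (hx : ∀ i, i + 1 < w.length + 1 → x i < x (i + 1))
    (hpx : ∀ i < w.length + 1, p.1 (x i) = -(-1) ^ i)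
    (hqx : ∀ i < w.length + 1, q.1 (x i) = -(-1) ^ i) {k : ℕ} (hk : 1 ≤ k) :
    -(-1) ^ k * ((D ^ k) p).1 0 < -(-1) ^ k * ((D ^ k) q).1 0 := by
  set r := p - q with hr
  set u := op w p with hu
  have hDu : D u + a • u = 0 := by rw [← op_cons', hp]
  have hDu' : D u = (-a) • u := (eq_neg_of_add_eq_zero_left hDu).trans (neg_smul a u).symm
  have hDku : (D ^ k) u = (-a) ^ k • u := by
    clear hk
    induction k with
    | zero => simp
    | succ k ih => rw [pow_succ', Module.End.mul_apply, ih, map_smul, hDu', smul_smul, pow_succ]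
  have hopr : op (b :: w) r = (b - a) • u := by
    rw [hr, map_sub, hq, sub_zero, op_cons', ← hu, hDu', ← add_smul]; congr 1; ring
  have hr0 : op (a :: b :: w) r = 0 := by
    rw [op_cons', hopr, map_smul, hDu', smul_smul, smul_smul, ← add_smul]
    rw [show (b - a) * -a + a * (b - a) = 0 by ring, zero_smul]
  have hupos : ∀ t, 0 < -(-1) ^ w.length * u.1 t := by
    obtain ⟨ξ, hξ⟩ := (op_sign_of_weakAlt w p x (σ := -1) (by norm_num) ⟨hx, fun i hi => by
      rw [hpx i hi]
      have : ((-1 : ℝ) ^ i) * (-1) ^ i = 1 := by rw [← mul_pow]; simp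
      linarith⟩).2 ⟨0, by simp, by rw [hpx 0 (by simp)]; simp⟩
    intro t
    have e := exp_mul_eq_of_D_add_smul_eq_zero hDu t ξ
    have h1 : 0 < Real.exp (a * t) * (-(-1) ^ w.length * u.1 t) := by
      have : 0 < Real.exp (a * ξ) * (-1 * (-1) ^ w.length * u.1 ξ) :=
        mul_pos (Real.exp_pos _) hξ
      linear_combination this + ((-1) ^ w.length) * e
    exact pos_of_mul_pos_right h1 (Real.exp_pos _).le
  have hl : ∀ c ∈ a :: b :: w, 0 < c := by
    intro c hc
    rcases List.mem_cons.1 hc with rfl | hc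
    · exact ha
    · rcases List.mem_cons.1 hc with rfl | hc
      · exact ha.trans hab
      · exact hw c hc
  -- Zeros alternate weakly with either initial sign; `1` is the choice that leads to a conflict
  -- with the sign of `u`.
  have hrx : WeakAlt r.1 (w.length + 1) x 1 := by
    refine ⟨hx, fun i hi => ?_⟩
    have : r.1 (x i) = p.1 (x i) - q.1 (x i) := rfl
    rw [this, hpx i hi, hqx i hi]; simp
  obtain ⟨y, hy, hwy⟩ := weakAlt_D_pow hl hr0 (by simp) hrx hk
  have hsub : ((D ^ k) r).1 0 = ((D ^ k) p).1 0 - ((D ^ k) q).1 0 := by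
    rw [hr, map_sub]; rfl
  by_contra hcon
  have hc := hwy.cons_zero (hx0.trans_lt hy) (by rw [hsub]; linarith)
  obtain ⟨ξ, hξ⟩ := (op_sign_of_weakAlt (b :: w) _ _ (by simp) hc).1
  rw [op_D_pow, hopr, map_smul, hDku] at hξ
  have e : -(1 * (-1) ^ k) * (-1) ^ (b :: w).length * ((b - a) • (-a) ^ k • u).1 ξ =
      -((b - a) * a ^ k * (-(-1) ^ w.length * u.1 ξ)) := by
    have h1 : ((b - a) • (-a) ^ k • u).1 ξ = (b - a) * ((-a) ^ k * u.1 ξ) := rfl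
    have h2 : (-1 : ℝ) ^ k * (-1) ^ k = 1 := by rw [← mul_pow]; simp
    rw [h1, neg_pow a, List.length_cons, pow_succ]
    linear_combination (-1) ^ w.length * (b - a) * a ^ k * u.1 ξ * h2
  rw [e] at hξ
  have : 0 < (b - a) * a ^ k * (-(-1) ^ w.length * u.1 ξ) :=
    mul_pos (mul_pos (sub_pos.2 hab) (pow_pos ha k)) (hupos ξ)
  linarith

/-- The exponents in `u` are replaced by `1` one at a time, `m` counting those already replaced.
Each replacement either changes nothing or strictly increases the signed derivative at `0`. -/
theorem eq_or_D_pow_zero_lt {u : List ℝ} {m : ℕ} (hu : ∀ c ∈ u, 0 < c ∧ c ≤ 1)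
    {S : smoothSpace} {x : ℕ → ℝ} (hx0 : 0 ≤ x 0)
    (hx : ∀ i, i + 1 < u.length + m → x i < x (i + 1))
    (hS : op (List.replicate (u.length + m) 1) S = 0)
    (hSx : ∀ i < u.length + m, S.1 (x i) = -(-1) ^ i)
    {p : smoothSpace} (hp : op (u ++ List.replicate m 1) p = 0)
    (hpx : ∀ i < u.length + m, p.1 (x i) = -(-1) ^ i) {k : ℕ} (hk : 1 ≤ k) :
    p = S ∨ -(-1) ^ k * ((D ^ k) p).1 0 < -(-1) ^ k * ((D ^ k) S).1 0 := by
  induction u generalizing m p with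
  | nil =>
    left
    simp only [List.length_nil, zero_add, List.nil_append] at *
    exact eq_of_eq_on_nodes hp hS x (by simpa using hx) (by
      intro i hi; rw [hpx i (by simpa using hi), hSx i (by simpa using hi)])
  | cons a u ih =>
    set w := u ++ List.replicate m (1 : ℝ) with hw
    have hlen : w.length = u.length + m := by simp [hw]
    have hlen' : (a :: u).length + m = w.length + 1 := by simp [hw]; omega
    have hlen2 : (a :: u).length + m = u.length + (m + 1) := by simp; omega
    have hwpos : ∀ c ∈ w, 0 < c := by
      intro c hc
      rcases List.mem_append.1 hc with hc | hc
      · exact (hu c (by simp [hc])).1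
      · rw [(List.mem_replicate.1 hc).2]; exact one_pos
    rw [hlen'] at hx hS hSx hpx
    obtain ⟨q, hq, hqx⟩ := exists_interpolant (1 :: w) x (by simpa using hx)
      (fun i => -(-1) ^ i)
    have hperm : op (1 :: w) = op (u ++ List.replicate (m + 1) 1) := by
      apply op_perm
      rw [hw, List.replicate_succ]
      exact List.perm_middle.symm
    have hlast := ih (m := m + 1) (fun c hc => hu c (by simp [hc]))
      (by rw [← hlen2, hlen']; exact hx) (by rw [← hlen2, hlen']; exact hS)
      (by rw [← hlen2, hlen']; exact hSx) (by rw [← hperm]; exact hq)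
      (by rw [← hlen2, hlen']; simpa using hqx)
    have hstep : p = q ∨ -(-1) ^ k * ((D ^ k) p).1 0 < -(-1) ^ k * ((D ^ k) q).1 0 := by
      rcases (hu a (by simp)).2.lt_or_eq with h | h
      · right
        exact D_pow_zero_lt_of_exponent_lt (hu a (by simp)).1 h hwpos hp hq hx0 hx hpx
          (by simpa using hqx) hk
      · left
        subst h
        exact eq_of_eq_on_nodes hp hq x hx fun i hi => by rw [hpx i hi, hqx i hi]
    rcases hstep with rfl | h1
    · exact hlast
    · rcases hlast with rfl | h2
      · exact Or.inr h1
      · exact Or.inr (h1.trans h2)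

/-- A solution bounded by `N` at the alternation points of the interpolant `q`. -/
theorem eq_or_abs_D_pow_zero_lt {l : List ℝ} (hl : ∀ a ∈ l, 0 < a) (hn : 1 ≤ l.length)
    {x : ℕ → ℝ} (hx0 : 0 ≤ x 0) (hx : ∀ i, i + 1 < l.length → x i < x (i + 1))
    {p q : smoothSpace} (hp : op l p = 0) (hq : op l q = 0)
    (hqx : ∀ i < l.length, q.1 (x i) = -(-1) ^ i) {N : ℝ}
    (hpN : ∀ i < l.length, |p.1 (x i)| ≤ N) {k : ℕ} (hk : 1 ≤ k) :
    (p = N • q ∨ p = (-N) • q) ∨ |((D ^ k) p).1 0| < N * (-(-1) ^ k * ((D ^ k) q).1 0) := by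
  have key : ∀ p : smoothSpace, op l p = 0 → (∀ i < l.length, |p.1 (x i)| ≤ N) →
      p = N • q ∨ -(-1) ^ k * ((D ^ k) p).1 0 < N * (-(-1) ^ k * ((D ^ k) q).1 0) := by
    intro p hp hpN
    by_cases hz : N • q - p = 0
    · left; exact (sub_eq_zero.1 hz).symm
    · right
      -- At the nodes `N q` equals `±N`, which dominates `p`, so `N q - p` alternates weakly with
      -- initial sign `-1`.
      have := D_pow_zero_sign hl hn (f := N • q - p) (by simp [hp, hq]) hz hx0 (σ := -1)
        (by norm_num) ⟨hx, fun i hi => by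
          have e : (N • q - p).1 (x i) = N * q.1 (x i) - p.1 (x i) := rfl
          rw [e, hqx i hi]
          have h1 := abs_le.1 (hpN i hi)
          rcases neg_one_pow_eq_or ℝ i with h | h <;> rw [h] <;> linarith⟩ hk
      have e : ((D ^ k) (N • q - p)).1 0 = N * ((D ^ k) q).1 0 - ((D ^ k) p).1 0 := by
        rw [map_sub, map_smul]; rfl
      rw [e] at this
      linarith
  rcases key p hp hpN with h1 | h1
  · exact Or.inl (Or.inl h1)
  · rcases key (-p) (by simp [hp]) (fun i hi => by
      have : (-p).1 (x i) = -p.1 (x i) := rfl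
      rw [this, abs_neg]; exact hpN i hi) with h2 | h2
    · left; right; exact (neg_eq_iff_eq_neg.1 h2).trans (neg_smul N q).symm
    · right
      have e : ((D ^ k) (-p)).1 0 = -((D ^ k) p).1 0 := by rw [map_neg]; rfl
      rw [e] at h2
      rw [abs_lt]
      rcases neg_one_pow_eq_or ℝ k with h | h <;> rw [h] at h1 h2 ⊢ <;>
        constructor <;> linarith

end smoothSpace

/-! ### Existence of an alternating extremal polynomial. -/

/-- Few alternations allow separation by few sign changes. The sign of the degree-`n` coefficient is
tracked so that a perturbation by `q` does not lower the extremal functional. -/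
theorem exists_polynomial_separating (n : ℕ) {A B : Set ℝ} (hA : IsCompact A) (hB : IsCompact B)
    (hAB : Disjoint A B)
    (hno : ¬ ∃ x : ℕ → ℝ, (∀ i < n, x i < x (i + 1)) ∧ ∀ i ≤ n, x i ∈ if Even i then A else B) :
    ∃ q : ℝ[X], q.natDegree ≤ n ∧ (∀ t ∈ A, 0 < q.eval t) ∧ (∀ t ∈ B, q.eval t < 0) ∧
      0 ≤ (-1) ^ (n + 1) * q.coeff n := by
  induction n generalizing A B with
  | zero =>
    refine ⟨-1, by simp, fun t ht => ?_, fun t _ => by simp, by simp⟩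
    exact absurd ⟨fun _ => t, by simp, fun i hi => by simpa [Nat.le_zero.1 hi] using ht⟩ hno
  | succ n ih =>
    rcases A.eq_empty_or_nonempty with rfl | hne
    · refine ⟨-1, by simp, by simp, fun t _ => by simp, ?_⟩
      simp [coeff_one]
    obtain ⟨a, haA, ha⟩ := hA.exists_isLeast hne
    obtain ⟨L, hL⟩ := hB.bddBelow
    -- The roles are swapped: an alternation starting in `B` to the right of `a` extends by `a`.
    -- Adjoining `[L, a]` to the other set controls the sign of `q` at the points of `B` below `a`,
    -- where the factor `X - z` changes sign.
    have hB' : IsCompact (B ∩ Set.Ici a) := hB.inter_right isClosed_Ici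
    have hA' : IsCompact (A ∪ Set.Icc L a) := hA.union isCompact_Icc
    have hne' : ∀ t ∈ B, t ≠ a := fun t ht h => Set.disjoint_left.1 hAB haA (h ▸ ht)
    obtain ⟨q, hq1, hq2, hq3, hq4⟩ := ih hB' hA' (by
      rw [Set.disjoint_left]
      rintro t ⟨htB, hta⟩ (htA | htI)
      · exact Set.disjoint_left.1 hAB htA htB
      · exact hne' t htB (le_antisymm htI.2 hta)) (by
      rintro ⟨x, hx, hxm⟩
      have h0 : x 0 ∈ B ∩ Set.Ici a := by simpa using hxm 0 (Nat.zero_le _)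
      have h0' : a < x 0 := lt_of_le_of_ne h0.2 (hne' _ h0.1).symm
      have hgt : ∀ i ≤ n, a < x i := by
        intro i
        induction i with
        | zero => exact fun _ => h0'
        | succ i ih => exact fun hi => (ih (by omega)).trans (hx i (by omega))
      refine hno ⟨fun i => Nat.casesOn i a x, fun i hi => ?_, fun i hi => ?_⟩
      · cases i with
        | zero => exact h0'
        | succ i => exact hx i (by omega)
      · cases i with
        | zero => simpa using haA
        | succ i =>
          have h1 := hxm i (by omega)
          have h2 := hgt i (by omega)
          by_cases he : Even i
          · simp only [he, if_true] at h1
            simpa [Nat.even_add_one, he] using h1.1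
          · simp only [he, if_false] at h1
            have : x i ∈ A := h1.resolve_right fun h => absurd h.2 (not_le.2 h2)
            simpa [Nat.even_add_one, he] using this)
    obtain ⟨z, hza, hz⟩ : ∃ z < a, ∀ t ∈ B, t ≤ a → t < z := by
      have hK : IsCompact (B ∩ Set.Iic a) := hB.inter_right isClosed_Iic
      rcases (B ∩ Set.Iic a).eq_empty_or_nonempty with he | hKne
      · exact ⟨a - 1, by linarith, fun t ht hta =>
          absurd (show t ∈ B ∩ Set.Iic a from ⟨ht, hta⟩) (by simp [he])⟩
      · obtain ⟨m, hm, hmax⟩ := hK.exists_isGreatest hKne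
        have : m < a := lt_of_le_of_ne hm.2 (hne' m hm.1)
        exact ⟨(m + a) / 2, by linarith, fun t ht hta => by linarith [hmax ⟨ht, hta⟩]⟩
    refine ⟨-((X - C z) * q), ?_, fun t ht => ?_, fun t ht => ?_, ?_⟩
    · rw [natDegree_neg]
      refine natDegree_mul_le.trans ?_
      rw [natDegree_X_sub_C]; omega
    · have h1 : q.eval t < 0 := hq3 t (Or.inl ht)
      have h2 : 0 < t - z := by linarith [ha ht]
      simp only [eval_neg, eval_mul, eval_sub, eval_X, eval_C]
      nlinarith
    · simp only [eval_neg, eval_mul, eval_sub, eval_X, eval_C]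
      rcases le_or_gt a t with hat | hat
      · have h1 : 0 < q.eval t := hq2 t ⟨ht, hat⟩
        have h2 : 0 < t - z := by linarith
        nlinarith
      · have h1 : q.eval t < 0 := hq3 t (Or.inr ⟨hL ht, hat.le⟩)
        have h2 : t - z < 0 := by linarith [hz t ht hat.le]
        nlinarith
    · rw [coeff_neg, coeff_X_sub_C_mul, coeff_eq_zero_of_natDegree_lt (by omega : q.natDegree < n + 1)]
      rw [pow_succ]
      linarith

/-- At extremal points `g` pushes `f` inward, elsewhere there is slack; compactness makes this
uniform on `[0, R]`, and beyond `R` both functions are small. -/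
theorem exists_perturbation_lt_one {f g : ℝ → ℝ} (hf : Continuous f) (hg : Continuous g)
    (hf0 : Tendsto f atTop (𝓝 0)) (hg0 : Tendsto g atTop (𝓝 0)) (hf1 : ∀ t, 0 ≤ t → |f t| ≤ 1)
    (hpos : ∀ t, 0 ≤ t → f t = -1 → 0 < g t) (hneg : ∀ t, 0 ≤ t → f t = 1 → g t < 0) :
    ∃ ε > 0, ∀ t, 0 ≤ t → |f t + ε * g t| < 1 := by
  obtain ⟨R, hR⟩ := eventually_atTop.1 ((hf0.abs.eventually (gt_mem_nhds (by simp : |(0:ℝ)| < 1 / 2))).and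
    (hg0.abs.eventually (gt_mem_nhds (by simp : |(0:ℝ)| < 1 / 2))))
  have key : ∀ᶠ ε in 𝓝 (0:ℝ), ∀ t ∈ Set.Icc (0:ℝ) R, 0 < ε → 0 ≤ t → |f t + ε * g t| < 1 := by
    refine isCompact_Icc.eventually_forall_of_forall_eventually
      (P := fun ε t => 0 < ε → 0 ≤ t → |f t + ε * g t| < 1) fun t ht => ?_
    have hF : Tendsto (fun z : ℝ × ℝ => f z.2 + z.1 * g z.2) (𝓝 (0, t)) (𝓝 (f t)) := by
      have hc : Continuous fun z : ℝ × ℝ => f z.2 + z.1 * g z.2 := by fun_prop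
      simpa using hc.tendsto (0, t)
    have hG : Tendsto (fun z : ℝ × ℝ => g z.2) (𝓝 (0, t)) (𝓝 (g t)) :=
      (hg.comp continuous_snd).tendsto (0, t)
    have hft := abs_le.1 (hf1 t ht.1)
    rcases eq_or_ne (f t) (-1) with h1 | h1
    · filter_upwards [hF.eventually (gt_mem_nhds (by linarith : f t < 1)),
        hG.eventually (lt_mem_nhds (hpos t ht.1 h1))] with z hz1 hz2 hz hz0
      have := (abs_le.1 (hf1 z.2 hz0)).1
      exact abs_lt.2 ⟨by nlinarith, hz1⟩
    rcases eq_or_ne (f t) 1 with h2 | h2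
    · filter_upwards [hF.eventually (lt_mem_nhds (by linarith : -1 < f t)),
        hG.eventually (gt_mem_nhds (hneg t ht.1 h2))] with z hz1 hz2 hz hz0
      have := (abs_le.1 (hf1 z.2 hz0)).2
      exact abs_lt.2 ⟨hz1, by nlinarith⟩
    · filter_upwards [hF.eventually (lt_mem_nhds (lt_of_le_of_ne hft.1 h1.symm)),
        hF.eventually (gt_mem_nhds (lt_of_le_of_ne hft.2 h2))] with z hz1 hz2 _ _
      exact abs_lt.2 ⟨hz1, hz2⟩
  have h1 : ∀ᶠ ε in 𝓝[>] (0:ℝ), ε < 1 := nhdsWithin_le_nhds (gt_mem_nhds one_pos)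
  obtain ⟨ε, hε, hε1, hε0⟩ := ((key.filter_mono nhdsWithin_le_nhds).and (h1.and self_mem_nhdsWithin)).exists
  have hε0 : 0 < ε := hε0
  refine ⟨ε, hε0, fun t ht => ?_⟩
  rcases le_or_gt t R with htR | htR
  · exact hε t ⟨ht, htR⟩ hε0 ht
  · obtain ⟨h2, h3⟩ := hR t htR.le
    rw [abs_lt] at h2 h3 ⊢
    constructor <;> nlinarith

theorem tendsto_polynomial_mul_exp_neg (q : ℝ[X]) :
    Tendsto (fun t => q.eval t * Real.exp (-t)) atTop (𝓝 0) := by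
  simpa only [Real.exp_neg, div_eq_mul_inv] using q.tendsto_div_exp_atTop

theorem continuous_polynomial_mul_exp_neg (q : ℝ[X]) :
    Continuous fun t => q.eval t * Real.exp (-t) := by fun_prop

theorem exists_max_abs_halfLine {f : ℝ → ℝ} (hf : Continuous f) (h0 : Tendsto f atTop (𝓝 0)) :
    ∃ s, 0 ≤ s ∧ ∀ t, 0 ≤ t → |f t| ≤ |f s| := by
  by_cases hz : ∀ t, 0 ≤ t → f t = 0
  · exact ⟨0, le_rfl, fun t ht => by rw [hz t ht, hz 0 le_rfl]⟩
  push Not at hz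
  obtain ⟨u, hu, hfu⟩ := hz
  obtain ⟨R, hR⟩ := eventually_atTop.1
    (h0.abs.eventually (gt_mem_nhds (by simpa using hfu : |(0:ℝ)| < |f u|)))
  have hmem : u ∈ Set.Icc 0 (max R u) := ⟨hu, le_max_right _ _⟩
  obtain ⟨s, hs, hmax⟩ := isCompact_Icc.exists_isMaxOn ⟨u, hmem⟩ hf.abs.continuousOn
  refine ⟨s, hs.1, fun t ht => ?_⟩
  rcases le_or_gt t (max R u) with h | h
  · exact hmax ⟨ht, h⟩
  · exact (hR t ((le_max_left _ _).trans h.le)).le.trans (hmax hmem)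

theorem exists_extremal_polynomial (n : ℕ) :
    ∃ q : ℝ[X], q.natDegree ≤ n ∧ (∀ t, 0 ≤ t → |q.eval t * Real.exp (-t)| ≤ 1) ∧
      0 < (-1) ^ (n + 1) * q.coeff n ∧
      ∀ p : ℝ[X], p.natDegree ≤ n → (∀ t, 0 ≤ t → |p.eval t * Real.exp (-t)| ≤ 1) →
        (-1) ^ (n + 1) * p.coeff n ≤ (-1) ^ (n + 1) * q.coeff n := by
  -- Polynomials are parametrized by their values at `0, …, n`; the constraint bounds the value at
  -- `i` by `e^i`, so the admissible set is compact.
  let v : Fin (n + 1) → ℝ := fun i => (i : ℕ)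
  have hv : Set.InjOn v (Finset.univ : Finset (Fin (n + 1))) := by
    intro i _ j _ h
    exact Fin.ext (Nat.cast_injective (R := ℝ) h)
  let Q : (Fin (n + 1) → ℝ) →ₗ[ℝ] ℝ[X] := Lagrange.interpolate Finset.univ v
  have hQdeg : ∀ r, (Q r).natDegree ≤ n := by
    intro r
    have := Lagrange.degree_interpolate_lt r hv
    rw [Finset.card_univ, Fintype.card_fin] at this
    by_cases h0 : Q r = 0
    · simp [h0]
    · exact Nat.lt_succ_iff.1 ((natDegree_lt_iff_degree_lt h0).2 this)
  have hQsurj : ∀ p : ℝ[X], p.natDegree ≤ n → p = Q fun i => p.eval (v i) := by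
    intro p hp
    refine Lagrange.eq_interpolate hv ?_
    rw [Finset.card_univ, Fintype.card_fin]
    exact lt_of_le_of_lt (degree_le_of_natDegree_le hp) (by exact_mod_cast Nat.lt_succ_self n)
  let K : Set (Fin (n + 1) → ℝ) := {r | ∀ t, 0 ≤ t → |(Q r).eval t * Real.exp (-t)| ≤ 1}
  have hcl : IsClosed K := by
    have : K = ⋂ t ∈ Set.Ici (0:ℝ), {r | |(Q r).eval t * Real.exp (-t)| ≤ 1} := by
      ext r; simp [K]
    rw [this]
    refine isClosed_biInter fun t _ => isClosed_le ?_ continuous_const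
    have h1 : Continuous fun r => (Q r).eval t :=
      ((Polynomial.leval t).comp Q).continuous_of_finiteDimensional
    fun_prop
  have hbd : Bornology.IsBounded K := by
    refine (Metric.isBounded_closedBall (x := (0 : Fin (n + 1) → ℝ))
      (r := Real.exp n)).subset fun r hr => ?_
    rw [mem_closedBall_zero_iff, pi_norm_le_iff_of_nonneg (Real.exp_pos _).le]
    intro i
    have h1 := hr (v i) (Nat.cast_nonneg _)
    have h2 : (Q r).eval (v i) = r i :=
      Lagrange.eval_interpolate_at_node r hv (Finset.mem_univ i)
    rw [h2, abs_mul, Real.abs_exp, Real.exp_neg, ← div_eq_mul_inv,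
      div_le_one (Real.exp_pos _)] at h1
    refine h1.trans (Real.exp_le_exp.2 ?_)
    exact Nat.cast_le.2 (Nat.lt_succ_iff.1 i.2)
  have hK : IsCompact K := Metric.isCompact_of_isClosed_isBounded hcl hbd
  have hcont : Continuous fun r => (-1) ^ (n + 1) * (Q r).coeff n :=
    (((Polynomial.lcoeff ℝ n).comp Q).continuous_of_finiteDimensional).const_mul _
  obtain ⟨r, hr, hmax⟩ := hK.exists_isMaxOn ⟨0, fun t _ => by simp⟩ hcont.continuousOn
  have hbest : ∀ p : ℝ[X], p.natDegree ≤ n → (∀ t, 0 ≤ t → |p.eval t * Real.exp (-t)| ≤ 1) →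
      (-1) ^ (n + 1) * p.coeff n ≤ (-1) ^ (n + 1) * (Q r).coeff n := by
    intro p hp hp1
    have hpQ := hQsurj p hp
    have := hmax (show (fun i => p.eval (v i)) ∈ K from by
      intro t ht; rw [← hpQ]; exact hp1 t ht)
    simp only [Set.mem_ofPred_eq, ← hpQ] at this
    exact this
  refine ⟨Q r, hQdeg r, hr, ?_, hbest⟩
  obtain ⟨s, hs, hsmax⟩ := exists_max_abs_halfLine (continuous_polynomial_mul_exp_neg (X ^ n))
    (tendsto_polynomial_mul_exp_neg (X ^ n))
  set M := |(X ^ n : ℝ[X]).eval s * Real.exp (-s)|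
  have hM : 0 < M + 1 := by positivity
  have h1 := hbest (C ((-1) ^ (n + 1) / (M + 1)) * X ^ n) (natDegree_C_mul_X_pow_le _ _) (by
    intro t ht
    have := hsmax t ht
    rw [eval_mul, eval_C, mul_assoc, abs_mul, abs_div, abs_pow, abs_neg, abs_one, one_pow,
      abs_of_pos hM, one_div, inv_mul_le_iff₀ hM]
    linarith)
  rw [coeff_C_mul, coeff_X_pow_self, mul_one, ← mul_div_assoc, ← mul_pow] at h1
  exact lt_of_lt_of_le (by simpa using hM) h1

/-- If the extremal polynomial had no such alternation, adding a small multiple of a separating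
polynomial would bring the norm below `1` without lowering the functional; rescaling would then beat
the maximum. -/
theorem exists_alternating_polynomial (n : ℕ) :
    ∃ q : ℝ[X], q.natDegree ≤ n ∧ (∀ t, 0 ≤ t → |q.eval t * Real.exp (-t)| ≤ 1) ∧
      ∃ x : ℕ → ℝ, (∀ i < n, x i < x (i + 1)) ∧
        ∀ i ≤ n, 0 ≤ x i ∧ (q.eval (x i) * Real.exp (-x i)) = -(-1) ^ i := by
  obtain ⟨q, hq1, hq2, hq3, hq4⟩ := exists_extremal_polynomial n
  refine ⟨q, hq1, hq2, ?_⟩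
  by_contra hno
  set f : ℝ → ℝ := fun t => q.eval t * Real.exp (-t) with hf
  have hfc : Continuous f := continuous_polynomial_mul_exp_neg q
  have hf0 : Tendsto f atTop (𝓝 0) := tendsto_polynomial_mul_exp_neg q
  have hcomp : ∀ c : ℝ, |c| = 1 → IsCompact {t | 0 ≤ t ∧ f t = c} := by
    intro c hc
    obtain ⟨R, hR⟩ := eventually_atTop.1
      (hf0.abs.eventually (gt_mem_nhds (by simp : |(0:ℝ)| < 1)))
    refine isCompact_Icc.of_isClosed_subset (s := Set.Icc 0 R)
      (isClosed_Ici.inter (isClosed_eq hfc continuous_const)) ?_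
    rintro t ⟨ht, htc⟩
    refine ⟨ht, ?_⟩
    by_contra! h
    have := hR t h.le
    rw [htc, hc] at this
    exact lt_irrefl _ this
  obtain ⟨g, hg1, hg2, hg3, hg4⟩ := exists_polynomial_separating n
    (hcomp (-1) (by simp)) (hcomp 1 (by simp))
    (Set.disjoint_left.2 fun t h1 h2 => by linarith [h1.2, h2.2]) (by
      rintro ⟨x, hx, hxm⟩
      refine hno ⟨x, hx, fun i hi => ?_⟩
      have := hxm i hi
      by_cases he : Even i
      · simp only [he, if_true] at this
        exact ⟨this.1, by rw [he.neg_one_pow]; exact this.2⟩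
      · simp only [he, if_false] at this
        exact ⟨this.1, by rw [(Nat.not_even_iff_odd.1 he).neg_one_pow, neg_neg]; exact this.2⟩)
  obtain ⟨ε, hε, hlt⟩ := exists_perturbation_lt_one hfc (continuous_polynomial_mul_exp_neg g) hf0
    (tendsto_polynomial_mul_exp_neg g) hq2
    (fun t ht h => mul_pos (hg2 t ⟨ht, h⟩) (Real.exp_pos _))
    (fun t ht h => mul_neg_of_neg_of_pos (hg3 t ⟨ht, h⟩) (Real.exp_pos _))
  set p := q + C ε * g
  have hp : ∀ t, p.eval t * Real.exp (-t) = f t + ε * (g.eval t * Real.exp (-t)) := by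
    intro t; simp only [p, f, eval_add, eval_mul, eval_C]; ring
  obtain ⟨s, hs, hsmax⟩ := exists_max_abs_halfLine (continuous_polynomial_mul_exp_neg p)
    (tendsto_polynomial_mul_exp_neg p)
  set M := |p.eval s * Real.exp (-s)|
  have hM1 : M < 1 := by simp only [M, hp]; exact hlt s hs
  have hM0 : 0 ≤ M := abs_nonneg _
  -- The midpoint of `M` and `1` still dominates the norm, is below `1`, and stays positive even if
  -- `M = 0`.
  have hc : 0 < (M + 1) / 2 := by linarith
  have h1 := hq4 (C ((M + 1) / 2)⁻¹ * p) (by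
      refine (natDegree_C_mul_le _ _).trans ((natDegree_add_le _ _).trans ?_)
      exact max_le hq1 ((natDegree_C_mul_le _ _).trans hg1)) (by
    intro t ht
    have := hsmax t ht
    rw [eval_mul, eval_C, mul_assoc, abs_mul, abs_of_pos (inv_pos.2 hc), inv_mul_le_iff₀ hc]
    linarith)
  rw [coeff_C_mul, mul_left_comm, inv_mul_le_iff₀ hc, coeff_add, coeff_C_mul] at h1
  have h2 : 0 ≤ ε * ((-1) ^ (n + 1) * g.coeff n) := mul_nonneg hε.le hg4
  nlinarith

/-! ### The uniform norm on the half-line. -/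

theorem bddAbove_halfLine {f : ℝ → ℝ} (hf : Continuous f) (h0 : Tendsto f atTop (𝓝 0)) :
    BddAbove ((fun t : ℝ => |f t|) '' Set.Ici 0) := by
  obtain ⟨s, -, hs⟩ := exists_max_abs_halfLine hf h0
  exact ⟨|f s|, by rintro _ ⟨t, ht, rfl⟩; exact hs t ht⟩

theorem abs_le_halfLineNorm {f : ℝ → ℝ} (hf : Continuous f) (h0 : Tendsto f atTop (𝓝 0))
    {t : ℝ} (ht : 0 ≤ t) : |f t| ≤ halfLineNorm f :=
  le_csSup (bddAbove_halfLine hf h0) ⟨t, ht, rfl⟩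

theorem halfLineNorm_le {f : ℝ → ℝ} {c : ℝ} (h : ∀ t, 0 ≤ t → |f t| ≤ c) : halfLineNorm f ≤ c :=
  csSup_le ⟨_, 0, Set.mem_Ici.2 le_rfl, rfl⟩ (by rintro _ ⟨t, ht, rfl⟩; exact h t ht)

theorem exists_halfLineNorm_eq {f : ℝ → ℝ} (hf : Continuous f) (h0 : Tendsto f atTop (𝓝 0)) :
    ∃ s, 0 ≤ s ∧ halfLineNorm f = |f s| := by
  obtain ⟨s, hs0, hs⟩ := exists_max_abs_halfLine hf h0
  exact ⟨s, hs0, le_antisymm (halfLineNorm_le hs) (abs_le_halfLineNorm hf h0 hs0)⟩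

theorem halfLineNorm_smul (c : ℝ) (f : ℝ → ℝ) : halfLineNorm (c • f) = |c| * halfLineNorm f := by
  rw [halfLineNorm, halfLineNorm, ← smul_eq_mul, ← Real.sSup_smul_of_nonneg (abs_nonneg c)]
  congr 1
  ext y
  simp [Set.mem_smul_set, abs_mul]

/-! ### Exponential polynomials as solutions of differential equations. -/

namespace smoothSpace

theorem aeval_D_X_add_C (a : ℝ) (f : smoothSpace) : aeval D (X + C a) f = D f + a • f := by
  rw [map_add, aeval_X, aeval_C, Algebra.algebraMap_eq_smul_one]; rfl

/-- The function `t ↦ t ^ m * exp (-a t)` as a smooth function. -/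
noncomputable def powExp (m : ℕ) (a : ℝ) : smoothSpace :=
  ⟨fun t => t ^ m * Real.exp (-a * t), by change ContDiff ℝ ∞ _; fun_prop⟩

theorem D_powExp_succ (m : ℕ) (a : ℝ) :
    D (powExp (m + 1) a) + a • powExp (m + 1) a = ((m : ℝ) + 1) • powExp m a := by
  ext t
  have h1 : HasDerivAt (fun s => Real.exp (-a * s)) (Real.exp (-a * t) * -a) t := by
    simpa using ((hasDerivAt_id t).const_mul (-a)).exp
  have h2 : HasDerivAt (fun s => s ^ (m + 1) * Real.exp (-a * s)) _ t :=
    (hasDerivAt_pow (m + 1) t).mul h1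
  change deriv (fun s => s ^ (m + 1) * Real.exp (-a * s)) t +
    a * (t ^ (m + 1) * Real.exp (-a * t)) = ((m : ℝ) + 1) * (t ^ m * Real.exp (-a * t))
  rw [h2.deriv]
  push_cast
  ring

theorem aeval_powExp (m : ℕ) (a : ℝ) : aeval D ((X + C a) ^ (m + 1)) (powExp m a) = 0 := by
  induction m with
  | zero =>
    rw [zero_add, pow_one, aeval_D_X_add_C]
    have : powExp 0 a = expNeg a := by ext t; simp [powExp, expNeg]
    rw [this, D_expNeg]
  | succ m ih =>
    rw [pow_succ, map_mul, Module.End.mul_apply, aeval_D_X_add_C, D_powExp_succ, map_smul, ih,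
      smul_zero]

/-- The index `i` and the earlier indices with the same exponent supply enough factors `X + h_i` to
annihilate the function. -/
theorem op_powExp {d : ℕ} (h : Fin d → ℝ) (i : Fin d) :
    op (List.ofFn h) (powExp (Nat.card {j : Fin d // j < i ∧ h j = h i}) (h i)) = 0 := by
  classical
  have hdvd : (X + C (h i)) ^ (Nat.card {j : Fin d // j < i ∧ h j = h i} + 1) ∣
      ((List.ofFn h).map fun a => X + C a).prod := by
    rw [List.map_ofFn, List.prod_ofFn]
    let s : Finset (Fin d) := insert i (Finset.univ.filter fun j => j < i ∧ h j = h i)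
    have h1 : ∏ j ∈ s, (X + C (h j)) =
        (X + C (h i)) ^ (Nat.card {j : Fin d // j < i ∧ h j = h i} + 1) := by
      rw [Finset.prod_congr rfl (g := fun _ => X + C (h i)), Finset.prod_const]
      · congr 1
        rw [Finset.card_insert_of_notMem (by simp), Nat.card_eq_fintype_card,
          Fintype.card_subtype]
      · intro j hj
        rcases Finset.mem_insert.1 hj with rfl | hj
        · rfl
        · rw [(Finset.mem_filter.1 hj).2.2]
    rw [← h1]
    exact Finset.prod_dvd_prod_of_subset _ _ _ (Finset.subset_univ s)
  obtain ⟨q, hq⟩ := hdvd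
  rw [op, hq, mul_comm, map_mul, Module.End.mul_apply, aeval_powExp, map_zero]

theorem exists_of_mem_expPoly {d : ℕ} {h : Fin d → ℝ} {p : ℝ → ℝ} (hp : p ∈ expPoly h) :
    ∃ P : smoothSpace, P.1 = p ∧ op (List.ofFn h) P = 0 := by
  have : expPoly h ≤ (LinearMap.ker (op (List.ofFn h))).map smoothSpace.subtype := by
    refine Submodule.span_le.2 ?_
    rintro _ ⟨i, rfl⟩
    exact ⟨_, op_powExp h i, rfl⟩
  obtain ⟨P, hP, rfl⟩ := this hp
  exact ⟨P, rfl, hP⟩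

theorem polynomial_mul_exp_mem_expPoly {d : ℕ} {q : ℝ[X]} (hq : q.natDegree < d) :
    (fun t => q.eval t * Real.exp (-t)) ∈ expPoly (onesVec d) := by
  have he : ∀ i : Fin d, expSystem (onesVec d) i = fun t => t ^ (i : ℕ) * Real.exp (-t) := by
    intro i
    funext t
    have : Nat.card {j : Fin d // j < i ∧ onesVec d j = onesVec d i} = i := by
      simp only [onesVec, and_true, Nat.card_eq_fintype_card, Fintype.card_subtype]
      rw [← Fin.card_Iio i]
      congr 1
      ext j; simp
    rw [expSystem, this]
    simp [onesVec]
  have h1 : (fun t => q.eval t * Real.exp (-t)) =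
      ∑ i : Fin d, q.coeff i • expSystem (onesVec d) i := by
    funext t
    rw [eval_eq_sum_range' hq, Finset.sum_apply, Finset.sum_mul, Finset.sum_range]
    refine Finset.sum_congr rfl fun i _ => ?_
    rw [he, Pi.smul_apply, smul_eq_mul, mul_assoc]
  rw [h1]
  exact Submodule.sum_mem _ fun i _ => Submodule.smul_mem _ _ (Submodule.subset_span ⟨i, rfl⟩)

/-! ### The pointwise derivative bound. -/

theorem D_pow_zero_pos {l : List ℝ} (hl : ∀ a ∈ l, 0 < a) (hn : 1 ≤ l.length) {p : smoothSpace}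
    (hp : op l p = 0) {x : ℕ → ℝ} (hx0 : 0 ≤ x 0) (hx : ∀ i, i + 1 < l.length → x i < x (i + 1))
    (hpx : ∀ i < l.length, p.1 (x i) = -(-1) ^ i) {k : ℕ} (hk : 1 ≤ k) :
    0 < -(-1) ^ k * ((D ^ k) p).1 0 := by
  have hne : p ≠ 0 := by
    rintro rfl
    have := hpx 0 hn
    simp at this
  have := D_pow_zero_sign hl hn hp hne hx0 (σ := -1) (by norm_num) ⟨hx, fun i hi => by
    rw [hpx i hi]
    rcases neg_one_pow_eq_or ℝ i with h | h <;> rw [h] <;> norm_num⟩ hk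
  linarith

/-- The interpolant `p` with exponents `h` mediates: the translate of `P` is compared with `N p`,
and `p` with `S`. Keeping the alternatives strict is what later identifies the equality case. -/
theorem eq_or_abs_D_pow_lt {d : ℕ} (hd : 1 ≤ d) {h : Fin d → ℝ} (hh : h ∈ orderedExponents d)
    {P S : smoothSpace} (hP : op (List.ofFn h) P = 0) (hS : op (List.replicate d 1) S = 0)
    {x : ℕ → ℝ} (hx0 : x 0 = 0) (hx : ∀ i, i + 1 < d → x i < x (i + 1))
    (hSx : ∀ i < d, S.1 (x i) = -(-1) ^ i) {N : ℝ} (hN : ∀ t, 0 ≤ t → |P.1 t| ≤ N)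
    {k : ℕ} (hk : 1 ≤ k) {t : ℝ} (ht : 0 ≤ t) :
    (shift t P = N • S ∨ shift t P = (-N) • S) ∨
      |((D ^ k) P).1 t| < N * (-(-1) ^ k * ((D ^ k) S).1 0) := by
  have hl : ∀ a ∈ List.ofFn h, 0 < a ∧ a ≤ 1 := by
    intro a ha
    obtain ⟨i, rfl⟩ := (List.mem_ofFn' h a).1 ha
    exact hh.2 i
  have hlen : (List.ofFn h).length = d := List.length_ofFn
  obtain ⟨p, hp, hpx⟩ := exists_interpolant (List.ofFn h) x (by rwa [hlen]) fun i => -(-1) ^ i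
  have hsp : op (List.ofFn h) (shift t P) = 0 := by rw [op_shift, hP, map_zero]
  have hxnn : ∀ i < d, 0 ≤ x i := by
    intro i
    induction i with
    | zero => exact fun _ => hx0.ge
    | succ i ih => exact fun hi => (ih (by omega)).trans (hx i hi).le
  have h1 := eq_or_abs_D_pow_zero_lt (fun a ha => (hl a ha).1) (by rwa [hlen]) hx0.ge
    (by rwa [hlen]) hsp hp hpx (N := N) (by
      intro i hi
      rw [hlen] at hi
      exact hN _ (add_nonneg (hxnn i hi) ht)) hk
  have h2 := eq_or_D_pow_zero_lt (m := 0) hl (S := S) hx0.ge (by rwa [hlen, add_zero])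
    (by rwa [hlen, add_zero]) (by rwa [hlen, add_zero]) (p := p) (by simpa using hp)
    (by rwa [hlen, add_zero] at *) hk
  have hval : ((D ^ k) (shift t P)).1 0 = ((D ^ k) P).1 t := by
    rw [D_pow_shift, shift_apply, zero_add]
  rw [hval] at h1
  have hN0 : 0 ≤ N := (abs_nonneg _).trans (hN 0 le_rfl)
  rcases h2 with rfl | h2
  · exact h1
  -- For `N = 0` the strict gain from `p` to `S` is lost, but then the translate vanishes.
  rcases hN0.eq_or_lt with rfl | hNpos
  · rcases h1 with h1 | h1
    · left; left; simpa using h1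
    · rw [zero_mul] at h1
      exact absurd h1 (not_lt.2 (abs_nonneg _))
  · right
    have hpos := D_pow_zero_pos (fun a ha => (hl a ha).1) (by rwa [hlen]) hp hx0.ge
      (by rwa [hlen]) hpx hk
    have habs : |((D ^ k) p).1 0| = -(-1) ^ k * ((D ^ k) p).1 0 := by
      rw [← abs_of_pos hpos, abs_mul, abs_neg, abs_pow, abs_neg, abs_one, one_pow, one_mul]
    have h3 := mul_lt_mul_of_pos_left h2 hNpos
    rcases h1 with h1 | h1
    · refine lt_of_le_of_lt (le_of_eq ?_) h3
      rw [← hval, ← habs, ← abs_of_pos hNpos]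
      rcases h1 with h1 | h1
      · rw [h1, map_smul, ← abs_mul]; rfl
      · rw [h1, map_smul, ← abs_mul, ← abs_neg (N * _), ← neg_mul]; rfl
    · exact h1.trans h3

end smoothSpace

/-! ### The Chebyshev polynomial and the sharp inequality. -/

open smoothSpace

theorem op_ofFn_onesVec (d : ℕ) : op (List.ofFn (onesVec d)) = op (List.replicate d 1) := by
  rw [← List.ofFn_const]; rfl

theorem onesVec_mem_orderedExponents (d : ℕ) : onesVec d ∈ orderedExponents d :=
  ⟨fun _ _ _ => le_rfl, fun _ => ⟨one_pos, le_rfl⟩⟩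

theorem pos_of_mem_ofFn {d : ℕ} {h : Fin d → ℝ} (hh : h ∈ orderedExponents d) :
    ∀ a ∈ List.ofFn h, 0 < a := by
  intro a ha
  obtain ⟨i, rfl⟩ := (List.mem_ofFn' h a).1 ha
  exact (hh.2 i).1

theorem IsChebyshevExpPoly.exists_smooth {d : ℕ} (hd : 1 ≤ d) {T : ℝ → ℝ}
    (hT : IsChebyshevExpPoly (onesVec d) T) :
    ∃ (S : smoothSpace) (x : ℕ → ℝ), S.1 = T ∧ op (List.replicate d 1) S = 0 ∧ x 0 = 0 ∧
      (∀ i, i + 1 < d → x i < x (i + 1)) ∧ ∀ i < d, S.1 (x i) = -(-1) ^ i := by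
  obtain ⟨hmem, -, ν, hν, hν0, hνT⟩ := hT
  obtain ⟨S, rfl, hS⟩ := exists_of_mem_expPoly hmem
  rw [op_ofFn_onesVec] at hS
  refine ⟨S, fun i => if h : i < d then ν ⟨i, h⟩ else 0, rfl, hS, ?_, fun i hi => ?_,
    fun i hi => ?_⟩
  · simp only [show 0 < d from hd, dif_pos]
    exact hν0 _ rfl
  · simp only [hi, (Nat.lt_succ_self i).trans hi, dif_pos]
    exact hν (Fin.mk_lt_mk.2 (Nat.lt_succ_self i))
  · simp only [hi, dif_pos]
    rw [hνT, pow_succ]; ring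

theorem exists_isChebyshevExpPoly {d : ℕ} (hd : 1 ≤ d) :
    ∃ S, IsChebyshevExpPoly (onesVec d) S := by
  obtain ⟨n, rfl⟩ : ∃ n, d = n + 1 := ⟨d - 1, by omega⟩
  obtain ⟨q, hq, hq1, x, hx, hqx⟩ := exists_alternating_polynomial n
  have hmem := polynomial_mul_exp_mem_expPoly (q := q) (d := n + 1) (by omega)
  set T : ℝ → ℝ := fun t => q.eval t * Real.exp (-t) with hT
  obtain ⟨S, hST, hS⟩ := exists_of_mem_expPoly hmem
  have hpos := pos_of_mem_ofFn (onesVec_mem_orderedExponents (n + 1))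
  have hTx : ∀ i ≤ n, S.1 (x i) = -(-1) ^ i := fun i hi => by rw [hST]; exact (hqx i hi).2
  -- Were the first node positive, all `n + 1` nodes would be interior extrema, giving `S'` too many
  -- zeros.
  have hx0 : x 0 = 0 := by
    by_contra hne
    have h0 : 0 < x 0 := lt_of_le_of_ne (hqx 0 (Nat.zero_le _)).1 (Ne.symm hne)
    have hxpos : ∀ i ≤ n, 0 < x i := by
      intro i
      induction i with
      | zero => exact fun _ => h0
      | succ i ih => exact fun hi => (ih (by omega)).trans (hx i (by omega))
    have hcrit : ∀ i ≤ n, (D S).1 (x i) = 0 := by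
      intro i hi
      have hnhds : ∀ᶠ t in 𝓝 (x i), |S.1 t| ≤ 1 := by
        filter_upwards [lt_mem_nhds (hxpos i hi)] with t ht
        rw [hST]; exact hq1 t ht.le
      rcases neg_one_pow_eq_or ℝ i with h | h
      · refine IsLocalMin.deriv_eq_zero ?_
        filter_upwards [hnhds] with t ht
        rw [hTx i hi, h]; exact (abs_le.1 ht).1
      · refine IsLocalMax.deriv_eq_zero ?_
        filter_upwards [hnhds] with t ht
        rw [hTx i hi, h, neg_neg]; exact (abs_le.1 ht).2
    have hDS : D S = 0 := by
      refine eq_zero_of_zeros (List.ofFn (onesVec (n + 1))) (by simpa using op_D_pow_eq_zero hS 1)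
        x (fun i hi => hx i ?_) (fun i hi => hcrit i ?_)
      · rw [List.length_ofFn] at hi; omega
      · rw [List.length_ofFn] at hi; omega
    refine D_ne_zero hpos hS ?_ hDS
    rintro rfl
    have := hTx 0 (Nat.zero_le _)
    simp at this
  refine ⟨T, hmem, ?_, fun i => x i, ?_, ?_, fun i => ?_⟩
  · refine le_antisymm (halfLineNorm_le hq1) ?_
    have := abs_le_halfLineNorm (continuous_polynomial_mul_exp_neg q)
      (tendsto_polynomial_mul_exp_neg q) (le_refl (0:ℝ))
    have h1 := hTx 0 (Nat.zero_le _)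
    rw [hx0, hST] at h1
    refine le_trans (le_of_eq ?_) this
    change 1 = |T 0|
    rw [h1]; simp
  · refine Fin.strictMono_iff_lt_succ.2 fun i => ?_
    exact hx i i.2
  · intro i hi
    simp only [hi, hx0]
  · rw [← hST, hTx i (Nat.lt_succ_iff.1 i.2), pow_succ]; ring

theorem abs_smooth_le_halfLineNorm {l : List ℝ} (hl : ∀ a ∈ l, 0 < a) {P : smoothSpace}
    (hP : op l P = 0) {t : ℝ} (ht : 0 ≤ t) : |P.1 t| ≤ halfLineNorm P.1 :=
  abs_le_halfLineNorm (continuous_coe P) (tendsto_zero hl hP) ht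

/-- Two distinct candidates would each have strictly larger derivative at `0` than the other;
opposite signs are excluded by the common value `-1` at `0`. -/
theorem isChebyshevExpPoly_unique {d : ℕ} (hd : 1 ≤ d) {T₁ T₂ : ℝ → ℝ}
    (h₁ : IsChebyshevExpPoly (onesVec d) T₁) (h₂ : IsChebyshevExpPoly (onesVec d) T₂) :
    T₁ = T₂ := by
  obtain ⟨S₁, x, rfl, hS₁, hx0, hx, hSx⟩ := h₁.exists_smooth hd
  obtain ⟨S₂, y, rfl, hS₂, hy0, hy, hSy⟩ := h₂.exists_smooth hd
  have hpos := pos_of_mem_ofFn (onesVec_mem_orderedExponents d)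
  have key : ∀ (S T : smoothSpace) (x y : ℕ → ℝ), op (List.replicate d 1) S = 0 →
      op (List.replicate d 1) T = 0 → x 0 = 0 → y 0 = 0 →
      (∀ i, i + 1 < d → x i < x (i + 1)) → (∀ i < d, S.1 (x i) = -(-1) ^ i) →
      (∀ i < d, T.1 (y i) = -(-1) ^ i) → halfLineNorm T.1 = 1 →
      T = S ∨ |(D T).1 0| < (D S).1 0 := by
    intro S T x y hS hT hx0 hy0 hx hSx hTy hT1
    have hT' : op (List.ofFn (onesVec d)) T = 0 := by rw [op_ofFn_onesVec]; exact hT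
    have := eq_or_abs_D_pow_lt hd (onesVec_mem_orderedExponents d) hT' hS hx0 hx hSx (N := 1)
      (fun t ht => hT1 ▸ abs_smooth_le_halfLineNorm hpos hT' ht) (le_refl 1) (le_refl (0:ℝ))
    have hsh : shift 0 T = T := by ext t; simp [shift_apply]
    rw [hsh, one_smul] at this
    rcases this with (h | h) | h
    · exact Or.inl h
    · exfalso
      have a1 := hSx 0 hd
      have a2 := hTy 0 hd
      have a3 : T.1 0 = -1 * S.1 0 := congrFun (congrArg Subtype.val h) 0
      rw [hx0] at a1; rw [hy0] at a2
      norm_num [a1, a2] at a3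
    · right; simpa using h
  rcases key S₁ S₂ x y hS₁ hS₂ hx0 hy0 hx hSx hSy h₂.2.1 with h | h
  · rw [h]
  rcases key S₂ S₁ y x hS₂ hS₁ hy0 hx0 hy hSy hSx h₁.2.1 with h' | h'
  · rw [h']
  · have := le_abs_self ((D S₁).1 0)
    have := le_abs_self ((D S₂).1 0)
    linarith

theorem corollary1 (d : ℕ) (hd : 1 ≤ d) :
    (∃! S : ℝ → ℝ, IsChebyshevExpPoly (onesVec d) S) ∧
    ∀ S : ℝ → ℝ, IsChebyshevExpPoly (onesVec d) S →
      ∀ k : ℕ, 1 ≤ k → ∀ h ∈ orderedExponents d, ∀ p ∈ expPoly h,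
        halfLineNorm (iteratedDeriv k p) ≤ markovConst k (onesVec d) * halfLineNorm p ∧
        (halfLineNorm (iteratedDeriv k p) = markovConst k (onesVec d) * halfLineNorm p ↔
          ∃ c : ℝ, p = c • S) := by
  refine ⟨?_, ?_⟩
  · obtain ⟨S, hS⟩ := exists_isChebyshevExpPoly hd
    exact ⟨S, hS, fun T hT => isChebyshevExpPoly_unique hd hT hS⟩
  intro T hT k hk h hh p hp
  obtain ⟨S, x, rfl, hS, hx0, hx, hSx⟩ := hT.exists_smooth hd
  obtain ⟨P, rfl, hP⟩ := exists_of_mem_expPoly hp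
  have hposS : ∀ a ∈ List.replicate d (1:ℝ), 0 < a := fun a ha => by
    rw [(List.mem_replicate.1 ha).2]; exact one_pos
  have hlen : (List.replicate d (1:ℝ)).length = d := List.length_replicate
  have hv : ∀ j, 1 ≤ j → 0 < -(-1) ^ j * ((D ^ j) S).1 0 := fun j hj =>
    D_pow_zero_pos hposS (by rwa [hlen]) hS hx0.ge (by rwa [hlen]) (by rwa [hlen]) hj
  set v := -(-1) ^ k * ((D ^ k) S).1 0 with hvdef
  have hvabs : |((D ^ k) S).1 0| = v := by
    rw [hvdef, ← abs_of_pos (hv k hk), abs_mul, abs_neg, abs_pow, abs_neg, abs_one, one_pow, one_mul]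
  have alt : ∀ {g : Fin d → ℝ}, g ∈ orderedExponents d → ∀ {R : smoothSpace},
      op (List.ofFn g) R = 0 → ∀ t, 0 ≤ t →
      (shift t R = halfLineNorm R.1 • S ∨ shift t R = (-halfLineNorm R.1) • S) ∨
        |((D ^ k) R).1 t| < halfLineNorm R.1 * v := fun {g} hg {R} hR t ht =>
    eq_or_abs_D_pow_lt hd hg hR hS hx0 hx hSx
      (fun s hs => abs_smooth_le_halfLineNorm (pos_of_mem_ofFn hg) hR hs) hk ht
  have bound : ∀ {g : Fin d → ℝ}, g ∈ orderedExponents d → ∀ {R : smoothSpace},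
      op (List.ofFn g) R = 0 → halfLineNorm (iteratedDeriv k R.1) ≤ v * halfLineNorm R.1 := by
    intro g hg R hR
    rw [← coe_D_pow]
    refine halfLineNorm_le fun t ht => ?_
    have h0 : 0 ≤ halfLineNorm R.1 := (abs_nonneg _).trans
      (abs_smooth_le_halfLineNorm (pos_of_mem_ofFn hg) hR le_rfl)
    have hval : ((D ^ k) R).1 t = ((D ^ k) (shift t R)).1 0 := by
      rw [D_pow_shift, shift_apply, zero_add]
    rcases alt hg hR t ht with (h1 | h1) | h1
    · have : ((D ^ k) (shift t R)).1 0 = halfLineNorm R.1 * ((D ^ k) S).1 0 := by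
        rw [h1, map_smul]; rfl
      rw [hval, this, abs_mul, hvabs, abs_of_nonneg h0, mul_comm]
    · have : ((D ^ k) (shift t R)).1 0 = -halfLineNorm R.1 * ((D ^ k) S).1 0 := by
        rw [h1, map_smul]; rfl
      rw [hval, this, abs_mul, hvabs, abs_neg, abs_of_nonneg h0, mul_comm]
    · linarith
  have hSnorm : halfLineNorm (iteratedDeriv k S.1) = v := by
    refine le_antisymm ?_ ?_
    · have := bound (onesVec_mem_orderedExponents d) (R := S) (by rw [op_ofFn_onesVec]; exact hS)
      rwa [hT.2.1, mul_one] at this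
    · rw [← hvabs, ← coe_D_pow]
      exact abs_smooth_le_halfLineNorm hposS (op_D_pow_eq_zero hS k) le_rfl
  have hM : markovConst k (onesVec d) = v := by
    refine IsGreatest.csSup_eq ⟨⟨S.1, hT.1, hT.2.1.le, hSnorm.symm⟩, ?_⟩
    rintro _ ⟨r, hr, hr1, rfl⟩
    obtain ⟨R, rfl, hR⟩ := exists_of_mem_expPoly hr
    have := bound (onesVec_mem_orderedExponents d) hR
    nlinarith [hv k hk]
  rw [hM]
  refine ⟨bound hh hP, fun heq => ?_, ?_⟩
  · set N := halfLineNorm P.1 with hN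
    have hNle : ∀ t, 0 ≤ t → |P.1 t| ≤ N := fun t ht =>
      abs_smooth_le_halfLineNorm (pos_of_mem_ofFn hh) hP ht
    -- Decay ensures that the norm of the derivative is attained; at that point equality rules out
    -- the strict alternative.
    obtain ⟨s, hs, hmax⟩ := exists_halfLineNorm_eq (continuous_coe ((D ^ k) P))
      (tendsto_zero (pos_of_mem_ofFn hh) (op_D_pow_eq_zero hP k))
    rw [← coe_D_pow, hmax] at heq
    obtain ⟨c, hcN, hc⟩ : ∃ c : ℝ, |c| = N ∧ shift s P = c • S := by
      have hN0 : 0 ≤ N := (abs_nonneg _).trans (hNle 0 le_rfl)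
      rcases alt hh hP s hs with (h1 | h1) | h1
      · exact ⟨N, abs_of_nonneg hN0, h1⟩
      · exact ⟨-N, by rw [abs_neg, abs_of_nonneg hN0], h1⟩
      · rw [heq, mul_comm] at h1
        exact absurd h1 (lt_irrefl _)
    have hcs : ∀ t, P.1 (t + s) = c * S.1 t := fun t => congrFun (congrArg Subtype.val hc) t
    rcases eq_or_ne c 0 with rfl | hc0
    · refine ⟨0, funext fun t => ?_⟩
      have := hcs (t - s)
      rw [sub_add_cancel] at this
      simpa using this
    refine ⟨c, funext fun t => ?_⟩
    have hs0 : s = 0 := by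
      by_contra hne
      have hspos : 0 < s := lt_of_le_of_ne hs (Ne.symm hne)
      have hS0 : S.1 0 = -1 := by simpa [hx0] using hSx 0 hd
      -- For `s > 0` the bound on `P` over `[0, s]` gives `|S| ≤ 1` on `[-s, 0]`, so the value `-1`
      -- at `0` would be a two-sided local minimum.
      have hmin : IsLocalMin S.1 0 := by
        filter_upwards [lt_mem_nhds (show -s < 0 by linarith)] with t ht
        have h1 := hNle (t + s) (by linarith)
        rw [hcs, abs_mul, ← hcN] at h1
        have h2 : |S.1 t| ≤ 1 := le_of_mul_le_mul_left (by rwa [mul_one]) (abs_pos.2 hc0)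
        rw [hS0]
        exact (abs_le.1 h2).1
      have h3 : 0 < (D S).1 0 := by simpa using hv 1 le_rfl
      exact h3.ne' hmin.deriv_eq_zero
    have := hcs t
    rwa [hs0, add_zero] at this
  · rintro ⟨c, hc⟩
    rw [hc, halfLineNorm_smul, hT.2.1]
    have : iteratedDeriv k (c • S.1) = c • iteratedDeriv k S.1 := by
      have h1 : c • S.1 = (c • S).1 := rfl
      rw [h1, ← coe_D_pow, ← coe_D_pow, map_smul]; rfl
    rw [this, halfLineNorm_smul, hSnorm]
    ring
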